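/- For $n\ge 0$ let $\mathfrak D_n$ be the set of derangements of $\{1,\dots,n\}$ (permutations without fixed points) and $$B_n(y,q)=\sum_{\sigma\in\mathfrak D_n}y^{\mathrm{wex}(\sigma)}q^{\mathrm{cr}(\sigma)},$$ where $\mathrm{wex}(\sigma)$ is the number of $i$ with $\sigma(i)\ge i$, and $\mathrm{cr}(\sigma)$ is the number of pairs $(i,j)$ such that $i<j\le\sigma(i)<\sigma(j)$ or $\sigma(i)<\sigma(j)<i<j$. Let $R$ be a commutative ring and let $y,q\in R$. (1) (Matrix Ansatz.) Let $D,E$ be matrices with entries in $R$, indexed by an arbitrary (possibly infinite) set, $\langle W|$ a row vector and $|V\rangle$ a column vector over $R$ such that $$DE-qED=I+qE+D,\qquad \langle W|E=0,\qquad D|V\rangle=0,\qquad \langle W|V\rangle=1. \qquad(*)$$ Suppose that the sums in matrix products are finite, in the sense that either the rows of $D$ and $E$ and the vector $\langle W|$ have finite support, or the columns of $D$ and $E$ and the vector $|V\rangle$ have finite support. Then for every $n\ge 0$ $$\langle W|(yD+E)^n|V\rangle=B_n(y,q).$$ The same holds if $D,E$ are endomorphisms of an arbitrary $R$-module $M$,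 $|V\rangle\in M$, and $\langle W|$ is an $R$-linear form on $M$, such that $(*)$ holds. (2) (Normal ordering.) In the unital associative $R$-algebra generated by $D$ and $E$ subject to the single relation $DE-qED=1+qE+D$, for every $n\ge 0$ the element $(yD+E)^n$ can be written in a unique way as a finite linear combination $\sum_{i,j\ge 0}c_{ij}E^iD^j$ with $c_{ij}\in R$, and its constant term is $c_{00}=B_n(y,q)$. -/

import Mathlib

universe u v w

namespace DerangementAnsatz

/-! Permutation statistics. Permutations of `{1, …, n}` are permutations of `Fin n`;
shifting the labels by one does not affect the statistics. -/

/-- The number of weak exceedances: indices `i` with `σ(i) ≥ i`. -/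
def wex {n : ℕ} (σ : Equiv.Perm (Fin n)) : ℕ :=
  (Finset.univ.filter fun i : Fin n => i ≤ σ i).card

/-- The number of crossings: pairs `(i, j)` with `i < j ≤ σ(i) < σ(j)`
or `σ(i) < σ(j) < i < j`. -/
def cr {n : ℕ} (σ : Equiv.Perm (Fin n)) : ℕ :=
  (Finset.univ.filter fun p : Fin n × Fin n =>
    (p.1 < p.2 ∧ p.2 ≤ σ p.1 ∧ σ p.1 < σ p.2) ∨
    (σ p.1 < σ p.2 ∧ σ p.2 < p.1 ∧ p.1 < p.2)).card

/-- `B_n(y, q)`, the sum of `y ^ wex(σ) * q ^ cr(σ)` over the derangements `σ` of `n` points. -/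
def B {R : Type u} [CommRing R] (n : ℕ) (y q : R) : R :=
  ∑ σ : derangements (Fin n), y ^ wex σ.1 * q ^ cr σ.1

/-! Matrices with a possibly infinite index set. Every sum written below with `∑ᶠ` has only
finitely many nonzero terms when the matrices are row-finite and row vectors have finite support,
and also when the matrices are column-finite and column vectors have finite support. -/

section InfiniteMatrices

variable {R : Type u} [CommRing R] {ι : Type v}

/-- Every row has finite support. -/
def RowFinite (A : Matrix ι ι R) : Prop := ∀ i, (Function.support fun j => A i j).Finite

/-- Every column has finite support. -/
def ColFinite (A : Matrix ι ι R) : Prop := ∀ j, (Function.support fun i => A i j).Finite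

/-- The product of two matrices. -/
noncomputable def mMul (A B : Matrix ι ι R) : Matrix ι ι R :=
  Matrix.of fun i j => ∑ᶠ k, A i k * B k j

/-- The powers of a matrix. -/
noncomputable def mPow [DecidableEq ι] (A : Matrix ι ι R) : ℕ → Matrix ι ι R
  | 0 => 1
  | n + 1 => mMul (mPow A n) A

/-- The row vector `⟨W|A`. -/
noncomputable def rowMul (W : ι → R) (A : Matrix ι ι R) : ι → R :=
  fun j => ∑ᶠ i, W i * A i j

/-- The column vector `A|V⟩`. -/
noncomputable def mulCol (A : Matrix ι ι R) (V : ι → R) : ι → R :=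
  fun i => ∑ᶠ j, A i j * V j

/-- The scalar `⟨W|V⟩`. -/
noncomputable def braket (W V : ι → R) : R := ∑ᶠ i, W i * V i

/-- All products of the matrices `D`, `E`, the row vector `W` and the column vector `V`
are finite sums. -/
def FiniteSums (D E : Matrix ι ι R) (W V : ι → R) : Prop :=
  (RowFinite D ∧ RowFinite E ∧ (Function.support W).Finite) ∨
  (ColFinite D ∧ ColFinite E ∧ (Function.support V).Finite)

/-- The relations `DE - qED = I + qE + D`, `⟨W|E = 0`, `D|V⟩ = 0`, `⟨W|V⟩ = 1`
for matrices and vectors. -/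
structure MatrixAnsatz [DecidableEq ι] (q : R) (D E : Matrix ι ι R) (W V : ι → R) : Prop where
  comm : mMul D E - q • mMul E D = 1 + q • E + D
  left : rowMul W E = 0
  right : mulCol D V = 0
  norm : braket W V = 1

end InfiniteMatrices

/-- The same relations for endomorphisms `D`, `E` of an arbitrary module, a linear form `W`
and a vector `V`. -/
structure OperatorAnsatz {R : Type u} [CommRing R] {M : Type w} [AddCommGroup M] [Module R M]
    (q : R) (D E : Module.End R M) (W : Module.Dual R M) (V : M) : Prop where
  comm : D * E - q • (E * D) = 1 + q • E + D
  left : W ∘ₗ E = 0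
  right : D V = 0
  norm : W V = 1

/-! Normal ordering: the algebra generated by two letters `D`, `E` subject to
`DE - qED = 1 + qE + D` only. -/

/-- The two letters. -/
inductive Letter
  | D
  | E

section NormalOrdering

variable {R : Type u} [CommRing R]

/-- The defining relation `DE - qED = 1 + qE + D`. -/
inductive Rel (q : R) : FreeAlgebra R Letter → FreeAlgebra R Letter → Prop
  | comm : Rel q
      (FreeAlgebra.ι R Letter.D * FreeAlgebra.ι R Letter.E
        - q • (FreeAlgebra.ι R Letter.E * FreeAlgebra.ι R Letter.D))
      (1 + q • FreeAlgebra.ι R Letter.E + FreeAlgebra.ι R Letter.D)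

/-- The algebra presented by the generators `D`, `E` and the relation above. -/
abbrev Alg (q : R) : Type u := RingQuot (Rel q)

/-- The generator `D`. -/
noncomputable def genD (q : R) : Alg q :=
  RingQuot.mkAlgHom R (Rel q) (FreeAlgebra.ι R Letter.D)

/-- The generator `E`. -/
noncomputable def genE (q : R) : Alg q :=
  RingQuot.mkAlgHom R (Rel q) (FreeAlgebra.ι R Letter.E)

/-- `c` is a (finitely supported) family of coefficients of a normal-ordered expansion
`x = ∑ c_{ij} E^i D^j`. -/
def IsNormalOrder (q : R) (x : Alg q) (c : ℕ × ℕ →₀ R) : Prop :=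
  x = c.sum fun ij a => a • (genE q ^ ij.1 * genD q ^ ij.2)

end NormalOrdering

end DerangementAnsatz

open DerangementAnsatz

namespace DerangementAnsatz

/-! ### Normal-ordered monomials form a basis, and expectation values are constant terms. -/

section Presentation

variable {R : Type u} [CommRing R]

/-! Everything reduces to one solution of the Ansatz. The relation moves every `D` to the right of
every `E`, so the monomials `E^i D^j` span the algebra; they are independent because the algebra
acts on the free module over pairs `(i, j)` as left multiplication should
(`existsUnique_isNormalOrder`). In any solution `⟨W|` kills a leading `E` and `D` kills `|V⟩`, so
the expectation of an element is its constant term `c₀₀`, whatever the solution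
(`OperatorAnsatz.apply_eq_constantTerm`).

It remains to evaluate one solution. `operatorAnsatz_model` gives one on functions of a height `h`,
with tridiagonal operators built from `q`-integers. A derangement of `n` points is built by adding,
for each new point, one row and one column to a fixed-point-free partial injection; `h` counts its
open rows, which are as many as its open columns. Each of the two is either left open or matched to
an earlier open partner, and the choice of partner contributes a `q`-integer of crossings. The four
cases together are exactly `yD + E` acting on a function of `h` (`sum_weight_succ`). Testing against
the indicator of `h = 0` leaves the derangements (`sum_matchings_eq_B`). -/

theorem genD_mul_genE (q : R) :
    genD q * genE q = q • (genE q * genD q) + 1 + q • genE q + genD q := by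
  have h := RingQuot.mkAlgHom_rel R (Rel.comm (q := q))
  simp only [map_sub, map_mul, map_smul, map_add, map_one] at h
  have h' : genD q * genE q - q • (genE q * genD q) = 1 + q • genE q + genD q := h
  rw [sub_eq_iff_eq_add] at h'
  rw [h']
  abel

/-- The representation of the presented algebra given by two operators satisfying the relation. -/
noncomputable def rep {A : Type w} [Ring A] [Algebra R A] (q : R) (D E : A)
    (h : D * E - q • (E * D) = 1 + q • E + D) : Alg q →ₐ[R] A :=
  RingQuot.liftAlgHom R ⟨FreeAlgebra.lift R (fun l => Letter.casesOn l D E), by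
    rintro _ _ ⟨⟩
    simpa using h⟩

theorem rep_genD {A : Type w} [Ring A] [Algebra R A] (q : R) (D E : A)
    (h : D * E - q • (E * D) = 1 + q • E + D) : rep q D E h (genD q) = D := by
  simp [rep, genD]

theorem rep_genE {A : Type w} [Ring A] [Algebra R A] (q : R) (D E : A)
    (h : D * E - q • (E * D) = 1 + q • E + D) : rep q D E h (genE q) = E := by
  simp [rep, genE]

/-- The span of the normal-ordered monomials. -/
noncomputable def normalSpan (q : R) : Submodule R (Alg q) :=
  Submodule.span R (Set.range fun ij : ℕ × ℕ => genE q ^ ij.1 * genD q ^ ij.2)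

theorem genE_mul_mem_normalSpan (q : R) {z : Alg q} (hz : z ∈ normalSpan q) :
    genE q * z ∈ normalSpan q := by
  induction hz using Submodule.span_induction with
  | mem x hx =>
    obtain ⟨⟨i, j⟩, rfl⟩ := hx
    exact Submodule.subset_span ⟨(i + 1, j), by simp only [pow_succ', mul_assoc]⟩
  | zero => simp
  | add x y _ _ hx hy => rw [mul_add]; exact add_mem hx hy
  | smul a x _ hx => rw [mul_smul_comm]; exact Submodule.smul_mem _ _ hx

theorem genD_mul_monomial_mem_normalSpan (q : R) (i j : ℕ) :
    genD q * (genE q ^ i * genD q ^ j) ∈ normalSpan q := by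
  induction i with
  | zero => exact Submodule.subset_span ⟨(0, j + 1), by simp [pow_succ']⟩
  | succ i ih =>
    have hm : genE q ^ i * genD q ^ j ∈ normalSpan q := Submodule.subset_span ⟨(i, j), rfl⟩
    have : genD q * (genE q ^ (i + 1) * genD q ^ j)
        = q • (genE q * (genD q * (genE q ^ i * genD q ^ j))) + genE q ^ i * genD q ^ j
          + q • (genE q * (genE q ^ i * genD q ^ j)) + genD q * (genE q ^ i * genD q ^ j) := by
      rw [pow_succ', mul_assoc, ← mul_assoc (genD q) (genE q), genD_mul_genE]
      simp only [add_mul, smul_mul_assoc, one_mul, mul_assoc]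
    rw [this]
    exact add_mem (add_mem (add_mem (Submodule.smul_mem _ _ (genE_mul_mem_normalSpan q ih)) hm)
      (Submodule.smul_mem _ _ (genE_mul_mem_normalSpan q hm))) ih

theorem genD_mul_mem_normalSpan (q : R) {z : Alg q} (hz : z ∈ normalSpan q) :
    genD q * z ∈ normalSpan q := by
  induction hz using Submodule.span_induction with
  | mem x hx =>
    obtain ⟨⟨i, j⟩, rfl⟩ := hx
    exact genD_mul_monomial_mem_normalSpan q i j
  | zero => simp
  | add x y _ _ hx hy => rw [mul_add]; exact add_mem hx hy
  | smul a x _ hx => rw [mul_smul_comm]; exact Submodule.smul_mem _ _ hx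

/-- Stability under left multiplication by both generators makes the span a left ideal; as it also
contains `1`, it is the whole algebra. -/
theorem mul_mem_normalSpan (q : R) (x : Alg q) :
    ∀ z ∈ normalSpan q, x * z ∈ normalSpan q := by
  obtain ⟨a, rfl⟩ := RingQuot.mkAlgHom_surjective R (Rel q) x
  induction a using FreeAlgebra.induction with
  | grade0 r =>
    intro z hz
    rw [AlgHom.commutes, ← Algebra.smul_def]
    exact Submodule.smul_mem _ _ hz
  | grade1 l =>
    intro z hz
    cases l
    · exact genD_mul_mem_normalSpan q hz
    · exact genE_mul_mem_normalSpan q hz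
  | mul a b ha hb =>
    intro z hz
    rw [map_mul, mul_assoc]
    exact ha _ (hb _ hz)
  | add a b ha hb =>
    intro z hz
    rw [map_add, add_mul]
    exact add_mem (ha _ hz) (hb _ hz)

theorem exists_isNormalOrder (q : R) (x : Alg q) : ∃ c, IsNormalOrder q x c := by
  have h := mul_mem_normalSpan q x 1 (Submodule.subset_span ⟨(0, 0), by simp⟩)
  rw [mul_one, normalSpan, Finsupp.mem_span_range_iff_exists_finsupp] at h
  obtain ⟨c, hc⟩ := h
  exact ⟨c, hc.symm⟩

/-- The expansion of `D * (E ^ i * D ^ j)` in the basis of normal-ordered monomials. -/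
noncomputable def mulDBasis (q : R) : ℕ → ℕ → (ℕ × ℕ →₀ R)
  | 0, j => Finsupp.single (0, j + 1) 1
  | i + 1, j => q • Finsupp.lmapDomain R R (Prod.map Nat.succ id) (mulDBasis q i j)
      + Finsupp.single (i, j) 1 + q • Finsupp.single (i + 1, j) 1 + mulDBasis q i j

/-- Left multiplication by `E` in the basis of normal-ordered monomials. -/
noncomputable def mulE (R : Type u) [CommRing R] : Module.End R (ℕ × ℕ →₀ R) :=
  Finsupp.lmapDomain R R (Prod.map Nat.succ id)

/-- Left multiplication by `D` in the basis of normal-ordered monomials. -/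
noncomputable def mulD (q : R) : Module.End R (ℕ × ℕ →₀ R) :=
  Finsupp.linearCombination R fun ij : ℕ × ℕ => mulDBasis q ij.1 ij.2

theorem mulE_single (i j : ℕ) :
    mulE R (Finsupp.single (i, j) 1) = Finsupp.single (i + 1, j) 1 := by
  simp [mulE, Finsupp.mapDomain_single]

theorem mulD_single (q : R) (i j : ℕ) :
    mulD q (Finsupp.single (i, j) 1) = mulDBasis q i j := by
  simp [mulD]

/-- On a basis vector this is the recursive clause of `mulDBasis`. -/
theorem mulD_mulE_comm (q : R) :
    mulD q * mulE R - q • (mulE R * mulD q) = 1 + q • mulE R + mulD q := by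
  refine Finsupp.lhom_ext' fun ⟨i, j⟩ => LinearMap.ext_ring ?_
  simp only [LinearMap.comp_apply, Finsupp.lsingle_apply, LinearMap.add_apply,
    LinearMap.sub_apply, LinearMap.smul_apply, Module.End.mul_apply, Module.End.one_apply,
    mulE_single, mulD_single]
  rw [mulDBasis]
  simp only [mulE]
  abel

theorem mulE_pow_mulD_pow (q : R) (i j : ℕ) :
    (mulE R ^ i * mulD q ^ j) (Finsupp.single (0, 0) 1) = Finsupp.single (i, j) 1 := by
  have hD : (mulD q ^ j) (Finsupp.single (0, 0) 1) = Finsupp.single (0, j) 1 := by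
    induction j with
    | zero => simp
    | succ j ih => rw [pow_succ', Module.End.mul_apply, ih, mulD_single, mulDBasis]
  rw [Module.End.mul_apply, hD]
  induction i with
  | zero => simp
  | succ i ih => rw [pow_succ', Module.End.mul_apply, ih, mulE_single]

/-- `E^i D^j` sends the basis vector at `(0, 0)` to the one at `(i, j)`, so the action of `x` on
that single vector displays all its coefficients. Uniqueness of the expansion follows. -/
theorem IsNormalOrder.eq_rep {q : R} {x : Alg q} {c : ℕ × ℕ →₀ R} (h : IsNormalOrder q x c) :
    c = rep q (mulD q) (mulE R) (mulD_mulE_comm q) x (Finsupp.single (0, 0) 1) := by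
  rw [IsNormalOrder] at h
  rw [h]
  simp only [Finsupp.sum, map_sum, map_smul, map_mul, map_pow, rep_genD, rep_genE,
    LinearMap.sum_apply, LinearMap.smul_apply, mulE_pow_mulD_pow]
  conv_lhs => rw [← Finsupp.sum_single c]
  simp [Finsupp.sum]

theorem existsUnique_isNormalOrder (q : R) (x : Alg q) : ∃! c, IsNormalOrder q x c := by
  obtain ⟨c, hc⟩ := exists_isNormalOrder q x
  exact ⟨c, hc, fun c' hc' => hc'.eq_rep.trans hc.eq_rep.symm⟩

/-- The expectation value of an element in any solution of the Ansatz is the constant term of its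
normal-ordered expansion. -/
theorem OperatorAnsatz.apply_eq_constantTerm {M : Type w} [AddCommGroup M] [Module R M] {q : R}
    {D E : Module.End R M} {W : Module.Dual R M} {V : M} (h : OperatorAnsatz q D E W V)
    {x : Alg q} {c : ℕ × ℕ →₀ R} (hc : IsNormalOrder q x c) :
    W (rep q D E h.comm x V) = c (0, 0) := by
  -- A rightmost `D` is killed by `V`, a leftmost `E` by `W`; only the empty monomial survives.
  have hmon (i j : ℕ) : W ((E ^ i * D ^ j) V) = if (i, j) = (0, 0) then 1 else 0 := by
    rcases j with _ | j
    · rcases i with _ | i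
      · simpa using h.norm
      · have := LinearMap.congr_fun h.left ((E ^ i) V)
        simpa [pow_succ'] using this
    · simp [pow_succ, h.right]
  rw [IsNormalOrder] at hc
  rw [hc]
  simp only [Finsupp.sum, map_sum, map_smul, map_mul, map_pow, rep_genD, rep_genE,
    LinearMap.sum_apply, LinearMap.smul_apply, hmon]
  simp

theorem OperatorAnsatz.rep_pow {M : Type w} [AddCommGroup M] [Module R M] {q : R}
    {D E : Module.End R M} {W : Module.Dual R M} {V : M} (h : OperatorAnsatz q D E W V)
    (y : R) (n : ℕ) :
    rep q D E h.comm ((y • genD q + genE q) ^ n) = (y • D + E) ^ n := by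
  simp only [map_pow, map_add, map_smul, rep_genD, rep_genE]

end Presentation

/-! ### Infinite matrices with finite sums as operators on modules. -/

section MatrixToOperator

variable {R : Type u} [CommRing R] {ι : Type v}

theorem exists_term_ne_zero {f : ι → R} (h : ∑ᶠ i, f i ≠ 0) : ∃ i, f i ≠ 0 := by
  by_contra! hf
  exact h (by simp [hf])

theorem braket_comm (v w : ι → R) : braket v w = braket w v :=
  finsum_congr fun _ => mul_comm _ _

theorem braket_smul_add {a v w : ι → R} (hv : (Function.support fun i => a i * v i).Finite)
    (hw : (Function.support fun i => a i * w i).Finite) (c : R) :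
    braket a (c • v + w) = c * braket a v + braket a w := by
  have hcv : (Function.support fun i => c * (a i * v i)).Finite :=
    hv.subset fun i hi => right_ne_zero_of_mul hi
  rw [braket, braket, braket, mul_finsum' _ _ hv, ← finsum_add_distrib hcv hw]
  exact finsum_congr fun i => by simp only [Pi.add_apply, Pi.smul_apply, smul_eq_mul]; ring

theorem finite_support_mul_left {a : ι → R} (ha : (Function.support a).Finite) (v : ι → R) :
    (Function.support fun i => a i * v i).Finite :=
  ha.subset fun _ hi => left_ne_zero_of_mul hi

theorem finite_support_mul_right (a : ι → R) {v : ι → R} (hv : (Function.support v).Finite) :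
    (Function.support fun i => a i * v i).Finite :=
  hv.subset fun _ hi => right_ne_zero_of_mul hi

/-- `⟨W|A` applied to `|v⟩` is `⟨W|` applied to `A|v⟩`, if `A` is row-finite and `W` is finitely
supported. -/
theorem braket_rowMul {A : Matrix ι ι R} (hA : RowFinite A) {W : ι → R}
    (hW : (Function.support W).Finite) (v : ι → R) :
    braket (rowMul W A) v = braket W (mulCol A v) := by
  classical
  -- The columns reachable from the support of `W`: inside this finite box both sides are finite
  -- double sums, and the order of summation may be exchanged.
  have hfin : (⋃ i ∈ hW.toFinset, Function.support fun j => A i j).Finite :=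
    Set.Finite.biUnion (Finset.finite_toSet _) fun i _ => hA i
  have hrow (i : ι) (hi : i ∈ hW.toFinset) (j : ι) (hj : A i j ≠ 0) : j ∈ hfin.toFinset := by
    rw [Set.Finite.mem_toFinset]
    exact Set.mem_biUnion hi hj
  have h1 (j : ι) : rowMul W A j = ∑ i ∈ hW.toFinset, W i * A i j :=
    finsum_eq_sum_of_support_subset _ fun i hi => by simpa using left_ne_zero_of_mul hi
  have h2 (i : ι) (hi : i ∈ hW.toFinset) : mulCol A v i = ∑ j ∈ hfin.toFinset, A i j * v j :=
    finsum_eq_sum_of_support_subset _ fun j hj => hrow i hi j (left_ne_zero_of_mul hj)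
  have h3 : braket W (mulCol A v) = ∑ i ∈ hW.toFinset, W i * mulCol A v i :=
    finsum_eq_sum_of_support_subset _ fun i hi => by simpa using left_ne_zero_of_mul hi
  have h4 : braket (rowMul W A) v = ∑ j ∈ hfin.toFinset, rowMul W A j * v j := by
    refine finsum_eq_sum_of_support_subset _ fun j hj => ?_
    have hj' := left_ne_zero_of_mul hj
    rw [h1] at hj'
    obtain ⟨i, hi, hij⟩ := Finset.exists_ne_zero_of_sum_ne_zero hj'
    exact hrow i hi j (right_ne_zero_of_mul hij)
  have h5 : ∑ i ∈ hW.toFinset, W i * mulCol A v i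
      = ∑ i ∈ hW.toFinset, ∑ j ∈ hfin.toFinset, W i * (A i j * v j) :=
    Finset.sum_congr rfl fun i hi => by rw [h2 i hi, Finset.mul_sum]
  rw [h3, h4, h5, Finset.sum_comm]
  refine Finset.sum_congr rfl fun j _ => ?_
  rw [h1, Finset.sum_mul]
  exact Finset.sum_congr rfl fun i _ => by ring

theorem mulCol_mMul_of_rowFinite {A B : Matrix ι ι R} (hA : RowFinite A) (hB : RowFinite B)
    (v : ι → R) : mulCol (mMul A B) v = mulCol A (mulCol B v) := by
  ext i
  exact braket_rowMul hB (hA i) v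

theorem mulCol_eq_rowMul_transpose (A : Matrix ι ι R) (v : ι → R) :
    mulCol A v = rowMul v A.transpose := by
  ext i
  exact finsum_congr fun k => mul_comm _ _

theorem ColFinite.transpose {A : Matrix ι ι R} (hA : ColFinite A) : RowFinite A.transpose := hA

/-- `⟨W|A` applied to `|v⟩` is `⟨W|` applied to `A|v⟩`, if `A` is column-finite and `v` is
finitely supported. -/
theorem braket_rowMul_of_colFinite {A : Matrix ι ι R} (hA : ColFinite A) (W : ι → R) {v : ι → R}
    (hv : (Function.support v).Finite) :
    braket (rowMul W A) v = braket W (mulCol A v) := by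
  rw [mulCol_eq_rowMul_transpose, braket_comm W, braket_rowMul hA.transpose hv, braket_comm,
    mulCol_eq_rowMul_transpose, Matrix.transpose_transpose]

theorem mulCol_mMul_of_colFinite {A B : Matrix ι ι R} (hB : ColFinite B) {v : ι → R}
    (hv : (Function.support v).Finite) : mulCol (mMul A B) v = mulCol A (mulCol B v) := by
  ext i
  exact braket_rowMul_of_colFinite hB (A i) hv

theorem mulCol_finite_support {A : Matrix ι ι R} (hA : ColFinite A) {v : ι → R}
    (hv : (Function.support v).Finite) : (Function.support (mulCol A v)).Finite := by
  refine (Set.Finite.biUnion hv fun j _ => hA j).subset fun i hi => ?_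
  obtain ⟨j, hj⟩ := exists_term_ne_zero hi
  exact Set.mem_biUnion (right_ne_zero_of_mul hj) (left_ne_zero_of_mul hj)

theorem RowFinite.mMul {A B : Matrix ι ι R} (hA : RowFinite A) (hB : RowFinite B) :
    RowFinite (mMul A B) := fun i => by
  refine (Set.Finite.biUnion (hA i) fun k _ => hB k).subset fun j hj => ?_
  obtain ⟨k, hk⟩ := exists_term_ne_zero hj
  exact Set.mem_biUnion (left_ne_zero_of_mul hk) (right_ne_zero_of_mul hk)

theorem RowFinite.smul_add {A B : Matrix ι ι R} (hA : RowFinite A) (hB : RowFinite B) (y : R) :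
    RowFinite (y • A + B) := fun i => by
  refine ((hA i).union (hB i)).subset fun j hj => ?_
  by_contra hcon
  simp only [Set.mem_union, Function.mem_support, not_or, not_not] at hcon
  exact hj (by simp [hcon.1, hcon.2])

theorem RowFinite.one [DecidableEq ι] : RowFinite (1 : Matrix ι ι R) := fun i =>
  (Set.finite_singleton i).subset fun j hj => by
    by_contra hij
    exact hj (Matrix.one_apply_ne (Ne.symm hij))

theorem RowFinite.mPow [DecidableEq ι] {A : Matrix ι ι R} (hA : RowFinite A) (n : ℕ) :
    RowFinite (mPow A n) := by
  induction n with
  | zero => exact RowFinite.one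
  | succ n ih => exact ih.mMul hA

theorem mulCol_one [DecidableEq ι] (v : ι → R) : mulCol 1 v = v := by
  ext i
  rw [mulCol, finsum_eq_single _ i fun j hj => by rw [Matrix.one_apply_ne hj.symm, zero_mul]]
  simp

theorem mulCol_smul_add_left_of_rowFinite {A B : Matrix ι ι R} (hA : RowFinite A)
    (hB : RowFinite B) (y : R) (v : ι → R) :
    mulCol (y • A + B) v = y • mulCol A v + mulCol B v := by
  ext i
  change braket (y • A i + B i) v = y * braket (A i) v + braket (B i) v
  rw [braket_comm, braket_smul_add (finite_support_mul_right v (hA i))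
    (finite_support_mul_right v (hB i)), braket_comm v, braket_comm v]

theorem mulCol_smul_add_left_of_finite (A B : Matrix ι ι R) (y : R) {v : ι → R}
    (hv : (Function.support v).Finite) :
    mulCol (y • A + B) v = y • mulCol A v + mulCol B v := by
  ext i
  change braket (y • A i + B i) v = y * braket (A i) v + braket (B i) v
  rw [braket_comm, braket_smul_add (finite_support_mul_left hv (A i))
    (finite_support_mul_left hv (B i)), braket_comm v, braket_comm v]

theorem mulCol_smul_add_of_rowFinite {A : Matrix ι ι R} (hA : RowFinite A) (c : R)
    (v w : ι → R) : mulCol A (c • v + w) = c • mulCol A v + mulCol A w := by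
  ext i
  exact braket_smul_add (finite_support_mul_left (hA i) v) (finite_support_mul_left (hA i) w) c

theorem mulCol_smul_add_of_finite (A : Matrix ι ι R) (c : R) {v w : ι → R}
    (hv : (Function.support v).Finite) (hw : (Function.support w).Finite) :
    mulCol A (c • v + w) = c • mulCol A v + mulCol A w := by
  ext i
  exact braket_smul_add (finite_support_mul_right (A i) hv) (finite_support_mul_right (A i) hw) c

/-- The form of the commutation relation without subtraction. -/
theorem MatrixAnsatz.mMul_eq [DecidableEq ι] {q : R} {D E : Matrix ι ι R} {W V : ι → R}
    (h : MatrixAnsatz q D E W V) :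
    -- Each sum has the shape `c • A + B`, with an artificial factor `1`, so that the
    -- `mulCol_smul_add_left` lemmas apply to all of them.
    mMul D E = q • mMul E D + (q • E + ((1 : R) • D + 1)) := by
  rw [sub_eq_iff_eq_add.mp h.comm, one_smul]
  abel

/-- A row-finite matrix acts on all column vectors. -/
noncomputable def RowFinite.toEnd {A : Matrix ι ι R} (hA : RowFinite A) :
    Module.End R (ι → R) :=
  IsLinearMap.mk' (mulCol A) <| by
    have h0 : mulCol A 0 = 0 := by
      ext i
      simp [mulCol]
    refine ⟨fun v w => ?_, fun c v => ?_⟩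
    · simpa using mulCol_smul_add_of_rowFinite hA 1 v w
    · simpa [h0] using mulCol_smul_add_of_rowFinite hA c v 0

theorem RowFinite.toEnd_apply {A : Matrix ι ι R} (hA : RowFinite A) (v : ι → R) :
    hA.toEnd v = mulCol A v := rfl

/-- A finitely supported row vector is a linear form on all column vectors. -/
noncomputable def rowForm {W : ι → R} (hW : (Function.support W).Finite) :
    Module.Dual R (ι → R) :=
  IsLinearMap.mk' (braket W) <| by
    have h0 : braket W 0 = 0 := by simp [braket]
    refine ⟨fun v w => ?_, fun c v => ?_⟩
    · simpa using braket_smul_add (finite_support_mul_left hW v) (finite_support_mul_left hW w) 1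
    · simpa [h0] using
        braket_smul_add (finite_support_mul_left hW v) (finite_support_mul_left hW 0) c

theorem rowForm_apply {W : ι → R} (hW : (Function.support W).Finite) (v : ι → R) :
    rowForm hW v = braket W v := rfl

theorem RowFinite.smul {A : Matrix ι ι R} (hA : RowFinite A) (c : R) : RowFinite (c • A) :=
  fun i => (hA i).subset fun _ hj => right_ne_zero_of_mul hj

theorem MatrixAnsatz.operatorAnsatz_of_rowFinite [DecidableEq ι] {q : R} {D E : Matrix ι ι R}
    {W V : ι → R} (h : MatrixAnsatz q D E W V) (hD : RowFinite D) (hE : RowFinite E)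
    (hW : (Function.support W).Finite) :
    OperatorAnsatz q hD.toEnd hE.toEnd (rowForm hW) V where
  comm := by
    refine LinearMap.ext fun v => ?_
    have hv : mulCol (mMul D E) v = _ := congrArg (mulCol · v) h.mMul_eq
    have h1 := RowFinite.one (R := R) (ι := ι)
    have hD1 := hD.smul_add h1 1
    rw [mulCol_mMul_of_rowFinite hD hE,
      mulCol_smul_add_left_of_rowFinite (hE.mMul hD) (hE.smul_add hD1 q),
      mulCol_smul_add_left_of_rowFinite hE hD1,
      mulCol_smul_add_left_of_rowFinite hD h1, mulCol_mMul_of_rowFinite hE hD, mulCol_one] at hv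
    simp only [LinearMap.sub_apply, LinearMap.add_apply, LinearMap.smul_apply,
      Module.End.mul_apply, Module.End.one_apply, RowFinite.toEnd_apply, hv]
    rw [one_smul]
    abel
  left := LinearMap.ext fun v => by
    rw [LinearMap.comp_apply, rowForm_apply, RowFinite.toEnd_apply, ← braket_rowMul hE hW, h.left]
    simp [braket]
  right := h.right
  norm := h.norm

theorem mulCol_mPow_of_rowFinite [DecidableEq ι] {D E : Matrix ι ι R} (hD : RowFinite D)
    (hE : RowFinite E) (y : R) (V : ι → R) (n : ℕ) :
    mulCol (mPow (y • D + E) n) V = ((y • hD.toEnd + hE.toEnd) ^ n) V := by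
  have hA := hD.smul_add hE y
  induction n generalizing V with
  | zero => exact mulCol_one V
  | succ n ih =>
    rw [mPow, mulCol_mMul_of_rowFinite (hA.mPow n) hA, ih, pow_succ, Module.End.mul_apply,
      mulCol_smul_add_left_of_rowFinite hD hE]
    rfl

/-- A column-finite matrix acts on finitely supported column vectors. -/
noncomputable def ColFinite.toEnd {A : Matrix ι ι R} (hA : ColFinite A) :
    Module.End R (ι →₀ R) :=
  IsLinearMap.mk' (fun v => Finsupp.ofSupportFinite (mulCol A v)
    (mulCol_finite_support hA v.hasFiniteSupport)) <| by
    have h0 : mulCol A 0 = 0 := by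
      ext i
      simp [mulCol]
    refine ⟨fun v w => DFunLike.coe_injective ?_, fun c v => DFunLike.coe_injective ?_⟩
    · change mulCol A (⇑v + ⇑w) = mulCol A v + mulCol A w
      simpa using mulCol_smul_add_of_finite A 1 v.hasFiniteSupport w.hasFiniteSupport
    · change mulCol A (c • ⇑v) = c • mulCol A v
      simpa [h0] using mulCol_smul_add_of_finite A c v.hasFiniteSupport (w := 0) (by simp)

theorem ColFinite.coe_toEnd_apply {A : Matrix ι ι R} (hA : ColFinite A) (v : ι →₀ R) :
    ⇑(hA.toEnd v) = mulCol A v := rfl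

/-- A row vector is a linear form on finitely supported column vectors. -/
noncomputable def rowFormFinsupp (W : ι → R) : Module.Dual R (ι →₀ R) :=
  IsLinearMap.mk' (fun v => braket W v) <| by
    have h0 : braket W 0 = 0 := by simp [braket]
    refine ⟨fun v w => ?_, fun c v => ?_⟩
    · simpa using braket_smul_add (finite_support_mul_right W v.hasFiniteSupport)
        (finite_support_mul_right W w.hasFiniteSupport) 1
    · simpa [h0] using braket_smul_add (finite_support_mul_right W v.hasFiniteSupport)
        (w := 0) (by simp) c

theorem rowFormFinsupp_apply (W : ι → R) (v : ι →₀ R) :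
    rowFormFinsupp W v = braket W v := rfl

theorem MatrixAnsatz.operatorAnsatz_of_colFinite [DecidableEq ι] {q : R} {D E : Matrix ι ι R}
    {W : ι → R} {V : ι →₀ R} (h : MatrixAnsatz q D E W V) (hD : ColFinite D) (hE : ColFinite E) :
    OperatorAnsatz q hD.toEnd hE.toEnd (rowFormFinsupp W) V where
  comm := by
    refine LinearMap.ext fun v => DFunLike.coe_injective ?_
    have hf := v.hasFiniteSupport
    have hv : mulCol (mMul D E) v = _ := congrArg (mulCol · v) h.mMul_eq
    rw [mulCol_mMul_of_colFinite hE hf, mulCol_smul_add_left_of_finite _ _ _ hf,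
      mulCol_smul_add_left_of_finite _ _ _ hf, mulCol_smul_add_left_of_finite _ _ _ hf,
      mulCol_mMul_of_colFinite hD hf, mulCol_one] at hv
    simp only [LinearMap.sub_apply, LinearMap.add_apply, LinearMap.smul_apply,
      Module.End.mul_apply, Module.End.one_apply, Finsupp.coe_sub, Finsupp.coe_add,
      Finsupp.coe_smul, ColFinite.coe_toEnd_apply, hv]
    rw [one_smul]
    abel
  left := LinearMap.ext fun v => by
    rw [LinearMap.comp_apply, rowFormFinsupp_apply, ColFinite.coe_toEnd_apply,
      ← braket_rowMul_of_colFinite hE W v.hasFiniteSupport, h.left]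
    simp [braket]
  right := DFunLike.coe_injective h.right
  norm := h.norm

theorem mulCol_mPow_of_colFinite [DecidableEq ι] {D E : Matrix ι ι R} (hD : ColFinite D)
    (hE : ColFinite E) (y : R) (V : ι →₀ R) (n : ℕ) :
    mulCol (mPow (y • D + E) n) V = ((y • hD.toEnd + hE.toEnd) ^ n) V := by
  have hA : ColFinite (y • D + E) :=
    -- Column-finiteness is, by definition, row-finiteness of the transpose.
    RowFinite.smul_add (A := D.transpose) (B := E.transpose) hD hE y
  induction n generalizing V with
  | zero => exact mulCol_one _
  | succ n ih =>
    rw [mPow, mulCol_mMul_of_colFinite hA V.hasFiniteSupport, pow_succ, Module.End.mul_apply, ← ih,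
      mulCol_smul_add_left_of_finite _ _ _ V.hasFiniteSupport]
    rfl

end MatrixToOperator

/-! ### Fixed-point-free partial injections and their growth by a row or a column. -/

section PartialMatchings

/-- Fixed-point-free partial injections from `{0, …, k - 1}` to `{0, …, m - 1}`, as graphs. -/
def matchings (k m : ℕ) : Finset (Finset (ℕ × ℕ)) :=
  (Finset.range k ×ˢ Finset.range m).powerset.filter fun S =>
    (∀ p ∈ S, p.1 ≠ p.2) ∧ (∀ p ∈ S, ∀ p' ∈ S, p.1 = p'.1 → p = p') ∧
      ∀ p ∈ S, ∀ p' ∈ S, p.2 = p'.2 → p = p'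

theorem mem_matchings {k m : ℕ} {S : Finset (ℕ × ℕ)} :
    S ∈ matchings k m ↔ (∀ p ∈ S, p.1 < k ∧ p.2 < m) ∧ (∀ p ∈ S, p.1 ≠ p.2) ∧
      (∀ p ∈ S, ∀ p' ∈ S, p.1 = p'.1 → p = p') ∧ ∀ p ∈ S, ∀ p' ∈ S, p.2 = p'.2 → p = p' := by
  simp [matchings, Finset.subset_iff]

/-- The elements of `{0, …, k - 1}` on which the partial injection is undefined. -/
def openRows (k : ℕ) (S : Finset (ℕ × ℕ)) : Finset ℕ :=
  (Finset.range k).filter fun i => ∀ p ∈ S, p.1 ≠ i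

theorem mem_openRows {k : ℕ} {S : Finset (ℕ × ℕ)} {i : ℕ} :
    i ∈ openRows k S ↔ i < k ∧ ∀ p ∈ S, p.1 ≠ i := by
  simp [openRows]

/-- The inverse partial injection. -/
def flip (S : Finset (ℕ × ℕ)) : Finset (ℕ × ℕ) := S.image Prod.swap

theorem mem_flip {S : Finset (ℕ × ℕ)} {p : ℕ × ℕ} : p ∈ flip S ↔ p.swap ∈ S := by
  simp only [flip, Finset.mem_image]
  constructor
  · rintro ⟨a, ha, rfl⟩
    simpa using ha
  · exact fun h => ⟨_, h, p.swap_swap⟩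

theorem flip_flip (S : Finset (ℕ × ℕ)) : flip (flip S) = S := by
  ext p
  simp [mem_flip]

theorem flip_insert (i j : ℕ) (S : Finset (ℕ × ℕ)) :
    flip (insert (i, j) S) = insert (j, i) (flip S) := by
  simp [flip, Finset.image_insert]

theorem flip_mem_matchings {k m : ℕ} {S : Finset (ℕ × ℕ)} (h : S ∈ matchings k m) :
    flip S ∈ matchings m k := by
  rw [mem_matchings] at h ⊢
  obtain ⟨h1, h2, h3, h4⟩ := h
  refine ⟨fun p hp => ?_, fun p hp => ?_, fun p hp p' hp' e => ?_, fun p hp p' hp' e => ?_⟩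
  · exact (h1 _ (mem_flip.mp hp)).symm
  · exact (h2 _ (mem_flip.mp hp)).symm
  · exact Prod.swap_injective (h4 _ (mem_flip.mp hp) _ (mem_flip.mp hp') e)
  · exact Prod.swap_injective (h3 _ (mem_flip.mp hp) _ (mem_flip.mp hp') e)

theorem insert_mem_matchings {k m i : ℕ} {S : Finset (ℕ × ℕ)} (h : S ∈ matchings k m)
    (hi : i ∈ openRows k S) (him : i ≠ m) : insert (i, m) S ∈ matchings k (m + 1) := by
  rw [mem_matchings] at h ⊢
  rw [mem_openRows] at hi
  obtain ⟨h1, h2, h3, h4⟩ := h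
  have hm : ∀ p ∈ S, p.2 ≠ m := fun p hp => (h1 p hp).2.ne
  refine ⟨?_, ?_, ?_, ?_⟩
  · simp only [Finset.forall_mem_insert]
    exact ⟨⟨hi.1, m.lt_succ_self⟩, fun p hp => ⟨(h1 p hp).1, (h1 p hp).2.trans m.lt_succ_self⟩⟩
  · simp only [Finset.forall_mem_insert]
    exact ⟨him, h2⟩
  · simp only [Finset.forall_mem_insert]
    exact ⟨⟨fun _ => trivial, fun p hp e => absurd e.symm (hi.2 p hp)⟩,
      fun p hp => ⟨fun e => absurd e (hi.2 p hp), h3 p hp⟩⟩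
  · simp only [Finset.forall_mem_insert]
    exact ⟨⟨fun _ => trivial, fun p hp e => absurd e.symm (hm p hp)⟩,
      fun p hp => ⟨fun e => absurd e (hm p hp), h4 p hp⟩⟩

theorem matchings_mono {k k' m m' : ℕ} (hk : k ≤ k') (hm : m ≤ m') :
    matchings k m ⊆ matchings k' m' := fun S h => by
  rw [mem_matchings] at h ⊢
  exact ⟨fun p hp => ⟨(h.1 p hp).1.trans_le hk, (h.1 p hp).2.trans_le hm⟩, h.2⟩

theorem subset_mem_matchings {k m : ℕ} {S T : Finset (ℕ × ℕ)} (h : S ∈ matchings k m)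
    (hT : T ⊆ S) : T ∈ matchings k m := by
  rw [mem_matchings] at h ⊢
  exact ⟨fun p hp => h.1 p (hT hp), fun p hp => h.2.1 p (hT hp),
    fun p hp p' hp' => h.2.2.1 p (hT hp) p' (hT hp'),
    fun p hp p' hp' => h.2.2.2 p (hT hp) p' (hT hp')⟩

/-- A matching with one more column is obtained by matching the new column or leaving it open. -/
theorem sum_matchings_succ_right {A : Type*} [AddCommMonoid A] (k m : ℕ)
    (F : Finset (ℕ × ℕ) → A) :
    ∑ S ∈ matchings k (m + 1), F S
      = ∑ S ∈ matchings k m, (F S + ∑ i ∈ (openRows k S).erase m, F (insert (i, m) S)) := by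
  classical
  rw [Finset.sum_add_distrib,
    ← Finset.sum_filter_add_sum_filter_not (matchings k (m + 1)) fun S => ∀ p ∈ S, p.2 ≠ m]
  congr 1
  · refine Finset.sum_congr ?_ fun _ _ => rfl
    ext S
    rw [Finset.mem_filter]
    constructor
    · rintro ⟨h, hS⟩
      rw [mem_matchings] at h ⊢
      exact ⟨fun p hp => ⟨(h.1 p hp).1,
        lt_of_le_of_ne (Nat.lt_succ_iff.mp (h.1 p hp).2) (hS p hp)⟩, h.2⟩
    · exact fun h => ⟨matchings_mono le_rfl m.le_succ h,
        fun p hp => ((mem_matchings.mp h).1 p hp).2.ne⟩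
  · rw [Finset.sum_sigma']
    symm
    -- The preimage is found by deleting the only pair in column `m`; its row differs from `m`
    -- because fixed points are excluded.
    refine Finset.sum_nbij (fun x => insert (x.2, m) x.1) ?_ ?_ ?_ fun _ _ => rfl
    · rintro ⟨S, i⟩ hx
      simp only [Finset.mem_sigma, Finset.mem_erase] at hx
      rw [Finset.mem_filter]
      refine ⟨insert_mem_matchings hx.1 hx.2.2 hx.2.1, fun h => ?_⟩
      exact h _ (Finset.mem_insert_self _ _) rfl
    · rintro ⟨S, i⟩ hx ⟨S', i'⟩ hx' e
      simp only [Finset.mem_coe, Finset.mem_sigma, Finset.mem_erase] at hx hx'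
      have hS : ∀ j, (j, m) ∉ S := fun j hj => ((mem_matchings.mp hx.1).1 _ hj).2.ne rfl
      have hS' : ∀ j, (j, m) ∉ S' := fun j hj => ((mem_matchings.mp hx'.1).1 _ hj).2.ne rfl
      dsimp only at e
      have hi : i = i' := by
        have : (i, m) ∈ insert (i', m) S' := e ▸ Finset.mem_insert_self _ _
        rcases Finset.mem_insert.mp this with h | h
        · exact (Prod.mk.inj h).1
        · exact absurd h (hS' i)
      subst hi
      have : S = S' := by
        rw [← Finset.erase_insert (hS i), e, Finset.erase_insert (hS' i)]
      rw [this]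
    · intro S hS
      simp only [Finset.coe_filter, Set.mem_ofPred_eq, not_forall, not_not] at hS
      obtain ⟨hS, ⟨i, j⟩, hp, rfl⟩ := hS
      have h := mem_matchings.mp hS
      refine ⟨⟨S.erase (i, j), i⟩, ?_, Finset.insert_erase hp⟩
      simp only [Finset.mem_coe, Finset.mem_sigma, Finset.mem_erase]
      refine ⟨?_, h.2.1 _ hp, ?_⟩
      · refine mem_matchings.mpr ⟨fun p hp' => ?_,
          (mem_matchings.mp (subset_mem_matchings hS (Finset.erase_subset _ _))).2⟩
        rw [Finset.mem_erase] at hp'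
        refine ⟨(h.1 p hp'.2).1, lt_of_le_of_ne (Nat.lt_succ_iff.mp (h.1 p hp'.2).2) fun e => ?_⟩
        exact hp'.1 (h.2.2.2 p hp'.2 _ hp e)
      · refine mem_openRows.mpr ⟨(h.1 _ hp).1, fun p hp' e => ?_⟩
        rw [Finset.mem_erase] at hp'
        exact hp'.1 (h.2.2.1 p hp'.2 _ hp e)

theorem sum_matchings_flip {A : Type*} [AddCommMonoid A] (k m : ℕ) (F : Finset (ℕ × ℕ) → A) :
    ∑ S ∈ matchings k m, F S = ∑ S ∈ matchings m k, F (flip S) :=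
  Finset.sum_bij' (fun S _ => flip S) (fun S _ => flip S) (fun _ h => flip_mem_matchings h)
    (fun _ h => flip_mem_matchings h) (fun S _ => flip_flip S) (fun S _ => flip_flip S)
    fun S _ => by rw [flip_flip]

/-- A matching with one more row is obtained by matching the new row or leaving it open. -/
theorem sum_matchings_succ_left {A : Type*} [AddCommMonoid A] (k m : ℕ)
    (F : Finset (ℕ × ℕ) → A) :
    ∑ S ∈ matchings (k + 1) m, F S
      = ∑ S ∈ matchings k m,
          (F S + ∑ j ∈ (openRows m (flip S)).erase k, F (insert (k, j) S)) := by
  rw [sum_matchings_flip, sum_matchings_succ_right, sum_matchings_flip]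
  exact Finset.sum_congr rfl fun S _ => by simp only [flip_insert, flip_flip]

theorem openRows_insert (k i j : ℕ) (S : Finset (ℕ × ℕ)) :
    openRows k (insert (i, j) S) = (openRows k S).erase i := by
  ext t
  simp only [mem_openRows, Finset.forall_mem_insert, Finset.mem_erase]
  tauto

theorem openRows_succ {k m : ℕ} {S : Finset (ℕ × ℕ)} (h : S ∈ matchings k m) :
    openRows (k + 1) S = insert k (openRows k S) := by
  rw [mem_matchings] at h
  ext t
  simp only [mem_openRows, Finset.mem_insert, Nat.lt_succ_iff_lt_or_eq]
  constructor
  · rintro ⟨h1 | h1, h2⟩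
    · exact Or.inr ⟨h1, h2⟩
    · exact Or.inl h1
  · rintro (rfl | h1)
    · exact ⟨Or.inr rfl, fun p hp => (h.1 p hp).1.ne⟩
    · exact ⟨Or.inl h1.1, h1.2⟩

theorem notMem_openRows_self (k : ℕ) (S : Finset (ℕ × ℕ)) : k ∉ openRows k S := fun h =>
  (mem_openRows.mp h).1.ne rfl

theorem card_openRows {k m : ℕ} {S : Finset (ℕ × ℕ)} (h : S ∈ matchings k m) :
    (openRows k S).card + S.card = k := by
  rw [mem_matchings] at h
  have hrows : S.image Prod.fst = (Finset.range k).filter fun i => ¬ ∀ p ∈ S, p.1 ≠ i := by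
    ext i
    simp only [Finset.mem_image, Finset.mem_filter, Finset.mem_range, not_forall, not_not,
      exists_prop]
    constructor
    · rintro ⟨p, hp, rfl⟩
      exact ⟨(h.1 p hp).1, p, hp, rfl⟩
    · exact fun hi => hi.2
  have hcard : (S.image Prod.fst).card = S.card :=
    Finset.card_image_of_injOn fun p hp p' hp' e => h.2.2.1 p hp p' hp' e
  rw [← hcard, hrows, openRows, Finset.card_filter_add_card_filter_not, Finset.card_range]

/-- Because of this equality a single height records both the open rows and the open columns. -/
theorem card_openRows_flip {k : ℕ} {S : Finset (ℕ × ℕ)} (h : S ∈ matchings k k) :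
    (openRows k (flip S)).card = (openRows k S).card := by
  have h1 := card_openRows h
  have h2 := card_openRows (flip_mem_matchings h)
  have h3 : (flip S).card = S.card := Finset.card_image_of_injective _ Prod.swap_injective
  omega

end PartialMatchings

/-! ### How exceedances and crossings change when a pair is inserted. -/

section Statistics

/-- Weak exceedances of a partial injection, where undefined values count as infinite. -/
def exceed (k : ℕ) (S : Finset (ℕ × ℕ)) : ℕ :=
  ((Finset.range k).filter fun i => ∀ p ∈ S, p.1 = i → i ≤ p.2).card

/-- Crossings of the arcs above (for `e = 1`), or strictly above (for `e = 0`), the diagonal of a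
partial injection, where undefined values count as infinite. -/
def arcCross (e : ℕ) (S : Finset (ℕ × ℕ)) : ℕ :=
  ∑ p ∈ S, ((Finset.Ioo p.1 (p.2 + e)).filter fun j => ∀ p' ∈ S, p'.1 = j → p.2 < p'.2).card

theorem exceed_succ {k m : ℕ} {S : Finset (ℕ × ℕ)} (h : S ∈ matchings k m) :
    exceed (k + 1) S = exceed k S + 1 := by
  rw [mem_matchings] at h
  rw [exceed, exceed, Finset.range_add_one, Finset.filter_insert, if_pos,
    Finset.card_insert_of_notMem]
  · simp
  · exact fun p hp e => absurd e (h.1 p hp).1.ne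

theorem exceed_insert_of_le {k i j : ℕ} (S : Finset (ℕ × ℕ)) (hij : i ≤ j) :
    exceed k (insert (i, j) S) = exceed k S := by
  rw [exceed, exceed]
  congr 1
  refine Finset.filter_congr fun t _ => ?_
  simp only [Finset.forall_mem_insert]
  exact ⟨fun h => h.2, fun h => ⟨fun e => e ▸ hij, h⟩⟩

theorem exceed_succ_insert {k j : ℕ} (S : Finset (ℕ × ℕ)) (hj : j < k) :
    exceed (k + 1) (insert (k, j) S) = exceed k S := by
  rw [exceed, exceed, Finset.range_add_one, Finset.filter_insert, if_neg]
  · congr 1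
    refine Finset.filter_congr fun t ht => ?_
    simp only [Finset.forall_mem_insert]
    exact ⟨fun h => h.2, fun h => ⟨fun e => absurd e (Finset.mem_range.mp ht).ne', h⟩⟩
  · exact fun h => absurd (h _ (Finset.mem_insert_self _ _) rfl) (not_le.mpr hj)

/-- The value `m` exceeds all present ones, so for the old arcs row `i` still counts as larger. The
rows crossing the new arc must have a value above `m`, hence are open. -/
theorem arcCross_insert_col {e m i : ℕ} {S : Finset (ℕ × ℕ)} (hm : ∀ p ∈ S, p.2 < m)
    (hi : ∀ p ∈ S, p.1 ≠ i) :
    arcCross e (insert (i, m) S)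
      = arcCross e S + ((openRows (m + e) S).filter fun j => i < j).card := by
  have hn : (i, m) ∉ S := fun h => hi _ h rfl
  rw [arcCross, Finset.sum_insert hn, add_comm, arcCross]
  congr 1
  · refine Finset.sum_congr rfl fun p hp => ?_
    congr 1
    refine Finset.filter_congr fun j _ => ?_
    simp only [Finset.forall_mem_insert]
    exact ⟨fun h => h.2, fun h => ⟨fun _ => hm p hp, h⟩⟩
  · congr 1
    ext j
    simp only [Finset.mem_filter, Finset.mem_Ioo, mem_openRows, Finset.forall_mem_insert]
    constructor
    · rintro ⟨⟨h1, h2⟩, _, h4⟩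
      exact ⟨⟨h2, fun p hp e => absurd (h4 p hp e) (hm p hp).le.not_gt⟩, h1⟩
    · rintro ⟨⟨h1, h2⟩, h3⟩
      exact ⟨⟨h3, h1⟩, fun e => absurd e h3.ne, fun p hp e => absurd e (h2 p hp)⟩

/-- The new arc spans an empty interval, and the intervals of the old arcs stop before `m`. -/
theorem arcCross_insert_row {e m j : ℕ} {S : Finset (ℕ × ℕ)} (hm : ∀ p ∈ S, p.2 + e ≤ m)
    (hrow : ∀ p ∈ S, p.1 ≠ m) (hj : j + e ≤ m + 1) :
    arcCross e (insert (m, j) S) = arcCross e S := by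
  have hn : (m, j) ∉ S := fun h => hrow _ h rfl
  have hempty : Finset.Ioo m (j + e) = ∅ := Finset.eq_empty_of_forall_notMem fun t ht => by
    rw [Finset.mem_Ioo] at ht
    omega
  rw [arcCross, Finset.sum_insert hn, hempty, Finset.filter_empty,
    Finset.card_empty, zero_add, arcCross]
  refine Finset.sum_congr rfl fun p hp => ?_
  congr 1
  refine Finset.filter_congr fun t ht => ?_
  have := hm p hp
  rw [Finset.mem_Ioo] at ht
  simp only [Finset.forall_mem_insert]
  exact ⟨fun h => h.2, fun h => ⟨fun e => by omega, h⟩⟩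

end Statistics

/-! ### A tridiagonal solution of the Ansatz and its combinatorial meaning. -/

section Model

variable {R : Type u} [CommRing R]

/-- The `q`-analogue `1 + q + ⋯ + q ^ (h - 1)` of `h`. -/
def qNat (q : R) (h : ℕ) : R := ∑ t ∈ Finset.range h, q ^ t

theorem qNat_zero (q : R) : qNat q 0 = 0 := rfl

theorem qNat_succ (q : R) (h : ℕ) : qNat q (h + 1) = q * qNat q h + 1 :=
  geom_sum_succ

/-- Summing `q` to the number of larger elements over a finite set gives a `q`-integer. -/
theorem sum_pow_card_filter_lt (q : R) (U : Finset ℕ) :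
    ∑ i ∈ U, q ^ (U.filter fun j => i < j).card = qNat q U.card := by
  induction U using Finset.induction_on_max with
  | empty => rfl
  | insert a s ha ih =>
    have has : a ∉ s := fun h => (ha a h).ne rfl
    have htop : (insert a s).filter (fun j => a < j) = ∅ :=
      Finset.filter_eq_empty_iff.mpr fun j hj => by
        rcases Finset.mem_insert.mp hj with rfl | hj
        · exact lt_irrefl _
        · exact (ha j hj).not_gt
    have hrest (i : ℕ) (hi : i ∈ s) : q ^ ((insert a s).filter fun j => i < j).card
        = q * q ^ (s.filter fun j => i < j).card := by
      rw [Finset.filter_insert, if_pos (ha i hi), Finset.card_insert_of_notMem, pow_succ']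
      exact fun h => has (Finset.mem_filter.mp h).1
    rw [Finset.sum_insert has, htop, Finset.sum_congr rfl hrest, ← Finset.mul_sum, ih,
      Finset.card_insert_of_notMem has, qNat_succ, Finset.card_empty, pow_zero, add_comm]

/-- The operator `D` of a tridiagonal solution of the Ansatz. -/
def modelD (q : R) : Module.End R (ℕ → R) where
  toFun φ h := φ (h + 1) + q * qNat q h * φ h
  map_add' φ ψ := by ext h; simp only [Pi.add_apply]; ring
  map_smul' c φ := by ext h; simp only [Pi.smul_apply, smul_eq_mul, RingHom.id_apply]; ring

/-- The operator `E` of a tridiagonal solution of the Ansatz. -/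
def modelE (q : R) : Module.End R (ℕ → R) where
  -- At `h = 0` the truncated `h - 1` is harmless, since its coefficient vanishes.
  toFun φ h := qNat q h * φ h + qNat q h ^ 2 * φ (h - 1)
  map_add' φ ψ := by ext h; simp only [Pi.add_apply]; ring
  map_smul' c φ := by ext h; simp only [Pi.smul_apply, smul_eq_mul, RingHom.id_apply]; ring

theorem modelD_apply (q : R) (φ : ℕ → R) (h : ℕ) :
    modelD q φ h = φ (h + 1) + q * qNat q h * φ h := rfl

theorem modelE_apply (q : R) (φ : ℕ → R) (h : ℕ) :
    modelE q φ h = qNat q h * φ h + qNat q h ^ 2 * φ (h - 1) := rfl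

theorem operatorAnsatz_model (q : R) :
    OperatorAnsatz q (modelD q) (modelE q) (LinearMap.proj 0) (Pi.single 0 1) where
  comm := by
    ext φ h
    simp only [LinearMap.sub_apply, LinearMap.add_apply, LinearMap.smul_apply,
      Module.End.mul_apply, Module.End.one_apply, Pi.sub_apply, Pi.add_apply, Pi.smul_apply,
      smul_eq_mul, modelD_apply, modelE_apply]
    rcases h with _ | h
    · simp [qNat_succ, qNat_zero, add_comm]
    · simp only [Nat.add_sub_cancel, qNat_succ]
      ring
  left := by
    ext φ
    simp [modelE_apply, qNat_zero]
  right := by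
    ext h
    rcases h with _ | h <;> simp [modelD_apply, qNat_zero]
  norm := by simp

/-- The weight of a partial injection. -/
def weight (y q : R) (k : ℕ) (S : Finset (ℕ × ℕ)) : R :=
  y ^ exceed k S * q ^ (arcCross 1 S + arcCross 0 (flip S))

theorem weight_succ (y q : R) {k m : ℕ} {S : Finset (ℕ × ℕ)} (h : S ∈ matchings k m) :
    weight y q (k + 1) S = y * weight y q k S := by
  rw [weight, exceed_succ h, weight]
  ring

/-- As `i ≤ n`, row `i` remains a weak exceedance, and only the crossings above the diagonal
increase; `weight_insert_row` is the mirror case, where row `n` is not an exceedance. -/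
theorem weight_insert_col (y q : R) {n i : ℕ} {S : Finset (ℕ × ℕ)} (h : S ∈ matchings (n + 1) n)
    (hi : i ∈ openRows (n + 1) S) :
    weight y q (n + 1) (insert (i, n) S)
      = q ^ ((openRows (n + 1) S).filter fun j => i < j).card * weight y q (n + 1) S := by
  have h1 := (mem_matchings.mp h).1
  rw [mem_openRows] at hi
  rw [weight, weight, exceed_insert_of_le S (Nat.lt_succ_iff.mp hi.1),
    arcCross_insert_col (fun p hp => (h1 p hp).2) hi.2, flip_insert, arcCross_insert_row]
  · ring
  · exact fun p hp => Nat.lt_succ_iff.mp (h1 _ (mem_flip.mp hp)).1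
  · exact fun p hp => (h1 _ (mem_flip.mp hp)).2.ne
  · exact hi.1.le

theorem weight_insert_row (y q : R) {n b : ℕ} {S : Finset (ℕ × ℕ)} (h : S ∈ matchings n n)
    (hb : b ∈ openRows n (flip S)) :
    weight y q (n + 1) (insert (n, b) S)
      = q ^ ((openRows n (flip S)).filter fun j => b < j).card * weight y q n S := by
  have h1 := (mem_matchings.mp h).1
  rw [mem_openRows] at hb
  rw [weight, weight, exceed_succ_insert S hb.1, flip_insert,
    arcCross_insert_col (fun p hp => (h1 _ (mem_flip.mp hp)).1) hb.2, arcCross_insert_row]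
  · rw [add_zero]
    ring
  · exact fun p hp => (h1 p hp).2
  · exact fun p hp => (h1 p hp).1.ne
  · have := hb.1
    omega

/-- One step of the transfer: the weighted sum over matchings of `n + 1` points is the weighted sum
over matchings of `n` points of the image of the test function under `yD + E`. -/
theorem sum_weight_succ (y q : R) (n : ℕ) (φ : ℕ → R) :
    ∑ S ∈ matchings (n + 1) (n + 1), weight y q (n + 1) S * φ (openRows (n + 1) S).card
      = ∑ S ∈ matchings n n,
          weight y q n S * (y • modelD q + modelE q) φ (openRows n S).card := by
  rw [sum_matchings_succ_right, sum_matchings_succ_left]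
  refine Finset.sum_congr rfl fun S hS => ?_
  have hS' : S ∈ matchings (n + 1) n := matchings_mono n.le_succ le_rfl hS
  have hn := notMem_openRows_self n S
  have hn' := notMem_openRows_self n (flip S)
  have hU : (openRows (n + 1) S).erase n = openRows n S := by
    rw [openRows_succ hS, Finset.erase_insert hn]
  have hc := card_openRows_flip hS
  set U := openRows n S with hUdef
  set L := openRows n (flip S) with hLdef
  have hUS : openRows (n + 1) S = insert n U := openRows_succ hS
  have hUb (b : ℕ) : openRows (n + 1) (insert (n, b) S) = U := by rw [openRows_insert, hU]
  -- Row `n` stays open and column `n` is matched. The extra `q` comes from the open row `n`, which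
  -- lies beyond every `i` in `U`.
  have hcol : ∑ i ∈ U, weight y q (n + 1) (insert (i, n) S)
        * φ (openRows (n + 1) (insert (i, n) S)).card
      = y * weight y q n S * (q * qNat q U.card) * φ U.card := by
    rw [← sum_pow_card_filter_lt, Finset.mul_sum, Finset.mul_sum, Finset.sum_mul]
    refine Finset.sum_congr rfl fun i hi => ?_
    have hi' : i ∈ openRows (n + 1) S := by rw [hUS]; exact Finset.mem_insert_of_mem hi
    have hin : i < n := (mem_openRows.mp hi).1
    rw [weight_insert_col y q hS' hi', openRows_insert, Finset.card_erase_of_mem hi', hUS,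
      Finset.card_insert_of_notMem hn, Nat.add_sub_cancel, Finset.filter_insert, if_pos hin,
      Finset.card_insert_of_notMem fun h => hn (Finset.mem_filter.mp h).1, weight_succ y q hS,
      pow_succ]
    ring
  -- Row `n` is matched to column `b`, and column `n` is either open or matched. Row `n` is no
  -- longer open, so no extra `q` appears.
  have hrow (b : ℕ) (hb : b ∈ L) :
      weight y q (n + 1) (insert (n, b) S) * φ (openRows (n + 1) (insert (n, b) S)).card
        + ∑ i ∈ (openRows (n + 1) (insert (n, b) S)).erase n,
            weight y q (n + 1) (insert (i, n) (insert (n, b) S))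
              * φ (openRows (n + 1) (insert (i, n) (insert (n, b) S))).card
      = q ^ (L.filter fun j => b < j).card
          * (weight y q n S * (φ U.card + qNat q U.card * φ (U.card - 1))) := by
    have hSb : insert (n, b) S ∈ matchings (n + 1) n := by
      have := flip_mem_matchings
        (insert_mem_matchings (flip_mem_matchings hS) hb (mem_openRows.mp hb).1.ne)
      rwa [flip_insert, flip_flip] at this
    have hsum : ∑ i ∈ U, weight y q (n + 1) (insert (i, n) (insert (n, b) S))
          * φ (openRows (n + 1) (insert (i, n) (insert (n, b) S))).card
        = qNat q U.card * (weight y q (n + 1) (insert (n, b) S) * φ (U.card - 1)) := by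
      rw [← sum_pow_card_filter_lt, Finset.sum_mul]
      refine Finset.sum_congr rfl fun i hi => ?_
      have hi' : i ∈ openRows (n + 1) (insert (n, b) S) := by rwa [hUb]
      rw [weight_insert_col y q hSb hi', openRows_insert _ i, hUb, Finset.card_erase_of_mem hi]
      ring
    rw [hUb, Finset.erase_eq_of_notMem hn, hsum, weight_insert_row y q hS hb]
    ring
  rw [hU, hcol, Finset.erase_eq_of_notMem hn', Finset.sum_congr rfl hrow, ← Finset.sum_mul,
    sum_pow_card_filter_lt, hc, weight_succ y q hS, hUS, Finset.card_insert_of_notMem hn]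
  simp only [LinearMap.add_apply, LinearMap.smul_apply, Pi.add_apply, Pi.smul_apply, smul_eq_mul,
    modelD_apply, modelE_apply]
  ring

theorem sum_weight_eq_model (y q : R) (n : ℕ) (φ : ℕ → R) :
    ∑ S ∈ matchings n n, weight y q n S * φ (openRows n S).card
      = ((y • modelD q + modelE q) ^ n) φ 0 := by
  induction n generalizing φ with
  | zero =>
    have : matchings 0 0 = {∅} := by
      ext S
      simp only [mem_matchings, Finset.mem_singleton]
      constructor
      · exact fun h => Finset.eq_empty_of_forall_notMem fun p hp => by simpa using h.1 p hp
      · rintro rfl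
        simp
    simp [this, weight, exceed, arcCross, openRows, flip]
  | succ n ih => rw [sum_weight_succ, ih, pow_succ, Module.End.mul_apply]

end Model

/-! ### Derangements as the matchings without open rows. -/

section Graph

/-- The graph of a permutation. -/
def graph {n : ℕ} (σ : Equiv.Perm (Fin n)) : Finset (ℕ × ℕ) :=
  Finset.univ.image fun i : Fin n => ((i : ℕ), (σ i : ℕ))

theorem mem_graph {n : ℕ} {σ : Equiv.Perm (Fin n)} {p : ℕ × ℕ} :
    p ∈ graph σ ↔ ∃ i : Fin n, ((i : ℕ), (σ i : ℕ)) = p := by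
  simp [graph]

theorem graph_injective {n : ℕ} : Function.Injective (graph : Equiv.Perm (Fin n) → _) := by
  intro σ τ h
  ext i
  obtain ⟨j, hj⟩ := mem_graph.mp (h ▸ mem_graph.mpr ⟨i, rfl⟩ : ((i : ℕ), (σ i : ℕ)) ∈ graph τ)
  rw [Prod.mk.injEq] at hj
  rw [← hj.2, Fin.ext hj.1]

theorem flip_graph {n : ℕ} (σ : Equiv.Perm (Fin n)) : flip (graph σ) = graph σ⁻¹ := by
  ext ⟨a, b⟩
  rw [mem_flip, mem_graph, mem_graph]
  constructor
  · rintro ⟨i, hi⟩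
    simp only [Prod.swap_prod_mk, Prod.mk.injEq] at hi
    exact ⟨σ i, by simp [hi]⟩
  · rintro ⟨i, hi⟩
    simp only [Prod.mk.injEq] at hi
    exact ⟨σ⁻¹ i, by simp [hi, ← hi.2]⟩

theorem forall_mem_graph {n : ℕ} {σ : Equiv.Perm (Fin n)} {P : ℕ × ℕ → Prop} :
    (∀ p ∈ graph σ, P p) ↔ ∀ i : Fin n, P (i, σ i) := by
  simp [graph]

theorem graph_mem_matchings {n : ℕ} {σ : Equiv.Perm (Fin n)} (h : ∀ i, σ i ≠ i) :
    graph σ ∈ matchings n n := by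
  simp only [mem_matchings, forall_mem_graph]
  refine ⟨fun i => ⟨i.2, (σ i).2⟩, fun i e => h i (Fin.ext e.symm), fun i j e => ?_,
    fun i j e => ?_⟩
  · rw [Fin.ext e]
  · rw [σ.injective (Fin.ext e)]

theorem openRows_graph {n : ℕ} (σ : Equiv.Perm (Fin n)) : openRows n (graph σ) = ∅ :=
  Finset.eq_empty_of_forall_notMem fun i hi => by
    rw [mem_openRows] at hi
    exact hi.2 _ (mem_graph.mpr ⟨⟨i, hi.1⟩, rfl⟩) rfl

theorem exists_graph_eq {n : ℕ} {S : Finset (ℕ × ℕ)} (hS : S ∈ matchings n n)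
    (hopen : openRows n S = ∅) : ∃ σ ∈ derangements (Fin n), graph σ = S := by
  obtain ⟨h1, h2, h3, h4⟩ := mem_matchings.mp hS
  have hex (i : Fin n) : ∃ j : Fin n, ((i : ℕ), (j : ℕ)) ∈ S := by
    by_contra! hcon
    have : (i : ℕ) ∈ openRows n S := mem_openRows.mpr ⟨i.2, fun p hp e => by
      refine hcon ⟨p.2, (h1 p hp).2⟩ ?_
      rw [← e]
      exact hp⟩
    simp [hopen] at this
  choose f hf using hex
  have hinj : Function.Injective f := fun i j e => by
    have := h4 _ (hf i) _ (hf j) (by rw [e])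
    exact Fin.ext (Prod.mk.inj this).1
  refine ⟨Equiv.ofBijective f (Finite.injective_iff_bijective.mp hinj),
    fun i e => h2 _ (hf i) (congrArg Fin.val e.symm), ?_⟩
  ext p
  rw [mem_graph]
  constructor
  · rintro ⟨i, rfl⟩
    exact hf i
  · intro hp
    exact ⟨⟨p.1, (h1 p hp).1⟩, h3 _ (hf _) _ hp rfl⟩

theorem exceed_graph {n : ℕ} (σ : Equiv.Perm (Fin n)) : exceed n (graph σ) = wex σ := by
  rw [exceed, wex, Finset.card_filter, Finset.card_filter, Finset.sum_range]
  refine Finset.sum_congr rfl fun i _ => ?_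
  congr 1
  rw [forall_mem_graph, eq_iff_iff]
  constructor
  · exact fun h => h i rfl
  · intro h j e
    rw [Fin.ext e]
    exact h

theorem arcCross_graph {n e : ℕ} (σ : Equiv.Perm (Fin n)) (he : e ≤ 1) :
    arcCross e (graph σ) = (Finset.univ.filter fun p : Fin n × Fin n =>
      p.1 < p.2 ∧ (p.2 : ℕ) < σ p.1 + e ∧ σ p.1 < σ p.2).card := by
  rw [arcCross, graph, Finset.sum_image fun i _ j _ h => Fin.ext (Prod.mk.inj h).1,
    Finset.card_filter, ← Finset.univ_product_univ, Finset.sum_product]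
  refine Finset.sum_congr rfl fun i _ => ?_
  rw [← Finset.card_filter]
  symm
  refine Finset.card_bij (fun j _ => (j : ℕ)) ?_ (fun _ _ _ _ h => Fin.ext h) ?_
  · intro j hj
    simp only [Finset.mem_filter, Finset.mem_univ, true_and] at hj
    simp only [Finset.mem_filter, Finset.mem_Ioo]
    refine ⟨⟨hj.1, hj.2.1⟩, forall_mem_graph.mpr fun j' e' => ?_⟩
    rw [Fin.ext e']
    exact hj.2.2
  · intro j hj
    simp only [Finset.mem_filter, Finset.mem_Ioo] at hj
    -- Here `e ≤ 1` is needed: `j < σ i + e ≤ n`.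
    have hjn : j < n := by
      have := (σ i).2
      omega
    refine ⟨⟨j, hjn⟩, ?_, rfl⟩
    simp only [Finset.mem_filter, Finset.mem_univ, true_and]
    exact ⟨hj.1.1, hj.1.2, forall_mem_graph.mp hj.2 ⟨j, hjn⟩ rfl⟩

/-- The shift `e = 1` turns `<` into the weak inequality `j ≤ σ(i)` of the first kind of crossing.
The second kind is strict, and becomes an upper crossing of the inverse when positions and values
are exchanged. -/
theorem arcCross_graph_add {n : ℕ} (σ : Equiv.Perm (Fin n)) :
    arcCross 1 (graph σ) + arcCross 0 (flip (graph σ)) = cr σ := by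
  rw [flip_graph, arcCross_graph σ le_rfl, arcCross_graph _ zero_le_one, cr,
    Finset.filter_or, Finset.card_union_of_disjoint]
  · congr 1
    · congr 1
      refine Finset.filter_congr fun p _ => ?_
      rw [Nat.lt_succ_iff, Fin.val_fin_le]
    · refine Finset.card_bij (fun p _ => (σ⁻¹ p.1, σ⁻¹ p.2)) ?_ ?_ ?_
      · simp only [Finset.mem_filter, Finset.mem_univ, true_and, add_zero, Fin.val_fin_lt]
        exact fun p hp => by simpa using hp
      · exact fun p _ p' _ h => Prod.ext (σ⁻¹.injective (Prod.mk.inj h).1)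
          (σ⁻¹.injective (Prod.mk.inj h).2)
      · simp only [Finset.mem_filter, Finset.mem_univ, true_and, add_zero, Fin.val_fin_lt]
        exact fun p hp => ⟨(σ p.1, σ p.2), by simpa using hp, by simp⟩
  · refine Finset.disjoint_filter.mpr fun p _ h h' => ?_
    exact absurd (h.1.trans_le h.2.1) (h'.1.trans h'.2.1).not_gt

theorem sum_matchings_eq_B {R : Type u} [CommRing R] (y q : R) (n : ℕ) :
    ∑ S ∈ matchings n n, weight y q n S * (Pi.single 0 1 : ℕ → R) (openRows n S).card
      = B n y q := by
  have hfilter : ∑ S ∈ matchings n n,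
        weight y q n S * (Pi.single 0 1 : ℕ → R) (openRows n S).card
      = ∑ S ∈ (matchings n n).filter (fun S => openRows n S = ∅), weight y q n S := by
    rw [Finset.sum_filter]
    refine Finset.sum_congr rfl fun S _ => ?_
    simp [Pi.single_apply]
  rw [hfilter, B]
  symm
  refine Finset.sum_nbij (fun σ => graph σ.1) ?_ ?_ ?_ ?_
  · exact fun σ _ => Finset.mem_filter.mpr ⟨graph_mem_matchings σ.2, openRows_graph σ.1⟩
  · exact fun σ _ τ _ h => Subtype.ext (graph_injective h)
  · intro S hS
    obtain ⟨hS, ho⟩ := Finset.mem_filter.mp hS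
    obtain ⟨σ, hσ, rfl⟩ := exists_graph_eq hS ho
    exact ⟨⟨σ, hσ⟩, Finset.mem_coe.mpr (Finset.mem_univ _), rfl⟩
  · exact fun σ _ => by rw [weight, exceed_graph, arcCross_graph_add]

end Graph

/-! ### Transfer from the model to all solutions. -/

section Main

variable {R : Type u} [CommRing R]

/-- The constant term may be computed in any solution; the model yields the sum over matchings. -/
theorem constantTerm_eq_B {y q : R} {n : ℕ} {c : ℕ × ℕ →₀ R}
    (hc : IsNormalOrder q ((y • genD q + genE q) ^ n) c) : c (0, 0) = B n y q := by
  have h := operatorAnsatz_model q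
  rw [← h.apply_eq_constantTerm hc, h.rep_pow, ← sum_matchings_eq_B, sum_weight_eq_model]
  rfl

theorem OperatorAnsatz.apply_pow {M : Type w} [AddCommGroup M] [Module R M] {q : R}
    {D E : Module.End R M} {W : Module.Dual R M} {V : M} (h : OperatorAnsatz q D E W V)
    (y : R) (n : ℕ) : W (((y • D + E) ^ n) V) = B n y q := by
  obtain ⟨c, hc⟩ := exists_isNormalOrder q ((y • genD q + genE q) ^ n)
  rw [← constantTerm_eq_B hc, ← h.apply_eq_constantTerm hc, h.rep_pow]

theorem MatrixAnsatz.braket_mPow {ι : Type v} [DecidableEq ι] {q : R} {D E : Matrix ι ι R}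
    {W V : ι → R} (h : MatrixAnsatz q D E W V) (hfin : FiniteSums D E W V) (y : R) (n : ℕ) :
    braket W (mulCol (mPow (y • D + E) n) V) = B n y q := by
  rcases hfin with ⟨hD, hE, hW⟩ | ⟨hD, hE, hV⟩
  · rw [mulCol_mPow_of_rowFinite hD hE, ← (h.operatorAnsatz_of_rowFinite hD hE hW).apply_pow y n]
    rfl
  · obtain ⟨V, rfl⟩ : ∃ V' : ι →₀ R, ⇑V' = V := ⟨Finsupp.ofSupportFinite V hV, rfl⟩
    rw [mulCol_mPow_of_colFinite hD hE, ← (h.operatorAnsatz_of_colFinite hD hE).apply_pow y n]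
    rfl

end Main

end DerangementAnsatz

theorem mainTheorem5 {R : Type u} [CommRing R] (y q : R) (n : ℕ) :
    (∀ (ι : Type v) [DecidableEq ι] (D E : Matrix ι ι R) (W V : ι → R),
      FiniteSums D E W V → MatrixAnsatz q D E W V →
        braket W (mulCol (mPow (y • D + E) n) V) = B n y q) ∧
    (∀ (M : Type w) [AddCommGroup M] [Module R M]
      (D E : Module.End R M) (W : Module.Dual R M) (V : M),
      OperatorAnsatz q D E W V → W (((y • D + E) ^ n) V) = B n y q) ∧
    (∃! c : ℕ × ℕ →₀ R, IsNormalOrder q ((y • genD q + genE q) ^ n) c) ∧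
    (∀ c : ℕ × ℕ →₀ R, IsNormalOrder q ((y • genD q + genE q) ^ n) c → c (0, 0) = B n y q) :=
  ⟨fun _ _ _ _ _ _ hfin h => h.braket_mPow hfin y n,
    fun _ _ _ _ _ _ _ h => h.apply_pow y n,
    existsUnique_isNormalOrder q _,
    fun _ hc => constantTerm_eq_B hc⟩
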